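/- A (priority-free) fluid timed Petri net consists of finite sets $\mathcal P$ (places) and $\mathcal Q$ (transitions) and the arcs of a bipartite directed graph between them, every arc $p\to q$ carrying a weight $\alpha_{qp}>0$ and every arc $q\to p$ a weight $\alpha_{pq}>0$ (real numbers). Write $x^{\mathrm{in}}$ and $x^{\mathrm{out}}$ for the sets of vertices immediately upstream and downstream of a vertex $x$. Every place $p$ has an initial marking $m_p\ge 0$ and a holding time $\tau_p\ge 0$ (real numbers, not necessarily rational), and every transition has at least one upstream place. Some places are ruled by preselection routing: such a place $p$ carries a stochastic vector $(\pi_{qp})_{q\in p^{\mathrm{out}}}$, and it is the only upstream place of each of its downstream transitions. There are no priority rules: every other place has at most one downstream transition $q$, for which we set $\pi_{qp}=1$. Let $T=\max_p\tau_p$. The dynamics of the counter functions $z_q$ is $$z_q(t)=\min_{p\in q^{\mathrm{in}}}\pi_{qp}\,\alpha_{qp}^{-1}\Big(m_p+\sum_{q'\in p^{\mathrm{in}}}\alpha_{pq'}\,z_{q'}(t-\tau_p)\Big)\qquad(q\in\mathcal Q).$$ A solution with initial condition $\varphi:[-T,0]\to\mathbb R^{\mathcal Q}$ is a function $z:[-T,\infty)\to\mathbb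 R^{\mathcal Q}$ that coincides with $\varphi$ on $[-T,0]$ and satisfies the dynamics at every $t>0$. An affine stationary regime is a pair $(\rho,u)\in(\mathbb R_{\ge0})^{\mathcal Q}\times\mathbb R^{\mathcal Q}$ such that $z(t)=\rho t+u$ $(t\ge -T)$ satisfies the dynamics at every $t\ge 0$. **Theorem.** Assume that the net is non-Zeno (its graph has no circuit all of whose places have zero holding time) and has a positive stoichiometric invariant, i.e. a vector $e\in(\mathbb R_{>0})^{\mathcal Q}$ with $e_q=\pi_{qp}\alpha_{qp}^{-1}\sum_{q'\in p^{\mathrm{in}}}\alpha_{pq'}e_{q'}$ for all $q\in\mathcal Q$ and $p\in q^{\mathrm{in}}$. Then: (i) There exists an affine stationary regime $(\rho,u)$ such that any solution with $z(t)=\rho t+u$ on $[-T,0]$ satisfies $z(t)=\rho t+u$ for all $t\ge0$. (ii) Let $(\rho,u)$ be any affine stationary regime. For every bounded (in particular, every continuous) initial condition $\varphi$ on $[-T,0]$, the dynamics has exactly one solution $z$ on $[-T,\infty)$ with initial condition $\varphi$, and $$z(t)=\rho t+O(1)\qquad(t\to\infty).$$ In particular the throughput $\rho$ does not depend on the initial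 condition. -/

import Mathlib

open Filter Asymptotics

/-- A fluid timed Petri net without priority rules, with finite sets `P` of places and `Q` of
transitions. Every place with several downstream transitions is ruled by proportional
preselection routing. -/
structure FluidPetriNet (P Q : Type*) [Fintype P] [Fintype Q] [DecidableEq P] where
  /-- the places upstream of a transition -/
  inQ : Q → Finset P
  /-- the transitions upstream of a place -/
  inP : P → Finset Q
  /-- `wQP q p` is the weight of the arc from the place `p` to the transition `q` -/
  wQP : Q → P → ℝ
  /-- `wPQ p q` is the weight of the arc from the transition `q` to the place `p` -/
  wPQ : P → Q → ℝ
  /-- initial marking -/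
  m : P → ℝ
  /-- holding times -/
  τ : P → ℝ
  /-- the places ruled by preselection routing -/
  psel : Finset P
  /-- `prop q p` is the proportion of the fluid entering `p ∈ psel` that is reserved to `q` -/
  prop : Q → P → ℝ
  /-- every transition has an upstream place (the dynamics takes a minimum over them) -/
  inQ_nonempty : ∀ q, (inQ q).Nonempty
  wQP_pos : ∀ q, ∀ p ∈ inQ q, 0 < wQP q p
  wPQ_pos : ∀ p, ∀ q ∈ inP p, 0 < wPQ p q
  m_nonneg : ∀ p, 0 ≤ m p
  τ_nonneg : ∀ p, 0 ≤ τ p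
  prop_nonneg : ∀ p ∈ psel, ∀ q, p ∈ inQ q → 0 ≤ prop q p
  /-- the proportions at a preselection place form a stochastic vector over its downstream
  transitions -/
  prop_sum : ∀ p ∈ psel, ∑ q with p ∈ inQ q, prop q p = 1
  /-- a transition downstream of a preselection place has no other upstream place -/
  psel_unique : ∀ p ∈ psel, ∀ q, p ∈ inQ q → inQ q = {p}
  /-- a place without routing rule has at most one downstream transition -/
  sync_unique : ∀ p, p ∉ psel → ∀ q q', p ∈ inQ q → p ∈ inQ q' → q = q'

namespace FluidPetriNet

variable {P Q : Type*} [Fintype P] [Fintype Q] [DecidableEq P]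

/-- The arcs of the underlying bipartite directed graph. -/
inductive Arc (N : FluidPetriNet P Q) : P ⊕ Q → P ⊕ Q → Prop
  | placeToTransition (p : P) (q : Q) (h : p ∈ N.inQ q) : Arc N (Sum.inl p) (Sum.inr q)
  | transitionToPlace (q : Q) (p : P) (h : q ∈ N.inP p) : Arc N (Sum.inr q) (Sum.inl p)

/-- The vertices that a zero-time circuit may visit: all transitions, and the places with zero
holding time. -/
def ZeroTime (N : FluidPetriNet P Q) : P ⊕ Q → Prop
  | Sum.inl p => N.τ p = 0
  | Sum.inr _ => True

/-- Non-Zeno: the graph has no circuit all of whose places have zero holding time. -/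
def NonZeno (N : FluidPetriNet P Q) : Prop :=
  ∀ x, ¬ Relation.TransGen (fun a b => N.Arc a b ∧ N.ZeroTime a ∧ N.ZeroTime b) x x

/-- The proportion `π_{qp}`, extended by `1` to places without preselection routing. -/
def routing (N : FluidPetriNet P Q) (q : Q) (p : P) : ℝ :=
  if p ∈ N.psel then N.prop q p else 1

/-- A stoichiometric invariant of the net. -/
def IsStoichiometricInvariant (N : FluidPetriNet P Q) (e : Q → ℝ) : Prop :=
  ∀ q, ∀ p ∈ N.inQ q,
    e q = N.routing q p * (N.wQP q p)⁻¹ * ∑ q' ∈ N.inP p, N.wPQ p q' * e q'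

/-- The total quantity of fluid `x_p(t)` that has entered the place `p` up to time `t`, given the
counter functions `z` of the transitions. -/
def placeCounter (N : FluidPetriNet P Q) (z : Q → ℝ → ℝ) (p : P) (t : ℝ) : ℝ :=
  N.m p + ∑ q' ∈ N.inP p, N.wPQ p q' * z q' t

/-- The counter equations at time `t`. If `q` is downstream of a preselection place `p`, then
`p` is its only upstream place and the equation reads `z_q(t) = π_{qp} α_{qp}⁻¹ x_p(t - τ_p)`;
otherwise it is the synchronization equation `z_q(t) = min_p α_{qp}⁻¹ x_p(t - τ_p)`. -/
def SatisfiesAt (N : FluidPetriNet P Q) (z : Q → ℝ → ℝ) (t : ℝ) : Prop :=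
  ∀ q, z q t = (N.inQ q).inf' (N.inQ_nonempty q) fun p =>
    N.routing q p * (N.wQP q p)⁻¹ * N.placeCounter z p (t - N.τ p)

/-- The maximal holding time `T`. -/
noncomputable def maxHolding (N : FluidPetriNet P Q) : ℝ := ⨆ p, N.τ p

/-- `z` is a solution of the dynamics on `[-T, ∞)` with initial condition `φ` on `[-T, 0]`
(only the values at times `≥ -T` matter). -/
def IsSolution (N : FluidPetriNet P Q) (φ z : Q → ℝ → ℝ) : Prop :=
  (∀ q, ∀ t ∈ Set.Icc (-N.maxHolding) 0, z q t = φ q t) ∧ ∀ t, 0 < t → N.SatisfiesAt z t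

/-- `t ↦ ρ t + u` is an affine stationary regime. -/
def IsAffineStationaryRegime (N : FluidPetriNet P Q) (ρ u : Q → ℝ) : Prop :=
  (∀ q, 0 ≤ ρ q) ∧ ∀ t, 0 ≤ t → N.SatisfiesAt (fun q s => ρ q * s + u q) t

/-- A bounded initial condition on `[-T, 0]`. -/
def BoundedInitial (N : FluidPetriNet P Q) (φ : Q → ℝ → ℝ) : Prop :=
  ∃ C : ℝ, ∀ q, ∀ t ∈ Set.Icc (-N.maxHolding) 0, |φ q t| ≤ C

end FluidPetriNet

/-!
In terms of the coefficients `gain` and `cost`, the dynamics is the Bellman equation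
`z_q(t) = min_p (cost q p + ∑ q', gain q p q' * z_q'(t - τ_p))` with nonnegative coefficients. It
is therefore monotone, and a stoichiometric invariant `e` makes it commute with the addition of
multiples of `e`. Since the net is non-Zeno, there is a potential `K t + h q` which drops by at
least `1` at each step backwards through a place (`NonZeno.exists_isPotential`). Induction along
this potential gives existence of solutions (`NonZeno.exists_isSolution`) and nonexpansiveness in
the sup-norm weighted by `e` (`NonZeno.abs_sub_le_of_initial`). Uniqueness of solutions, and
bounded distance to any affine stationary regime, are consequences of nonexpansiveness.

The existence of an affine stationary regime follows Kohlberg's argument for invariant half-lines.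
Consider the discounted equation `v_q = min_p (cost q p + (1 - λ τ_p) ∑ q', gain q p q' * v_q')`.
The potential provides a supersolution `e_q (K / λ + h_q)`, up to a factor, so that monotone
iteration from `0` yields a solution with `0 ≤ v(λ) = O(1 / λ)`. There are finitely many policies,
so a single policy attains the minimum for arbitrarily small `λ`; along those `λ`, Cramer's rule
makes `v` a rational function of `λ`, hence `v(λ) = ρ / λ + u + o(1)`. With `t = 1 / λ`, the
discounted slack of each place is the slack of the affine trajectory `ρ t + u` up to `o(1)`. The
latter slack is affine in `t`; being nonnegative up to `o(1)` for arbitrarily large `t`, it is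
nonnegative for all large `t`, and it vanishes for the selected policy. Adding a large multiple of
`ρ` to `u`, which amounts to a shift of time, gives a regime valid for all `t ≥ 0`.
-/

namespace FluidPetriNet

variable {P Q : Type*} [Fintype P] [Fintype Q] [DecidableEq P]

/-! ### The dynamics as a Bellman equation -/

open Classical in
/-- The coefficient of the counter of `q'` in the term of the counter equation of `q` that comes
from the place `p`. -/
noncomputable def gain (N : FluidPetriNet P Q) (q : Q) (p : P) (q' : Q) : ℝ :=
  N.routing q p * (N.wQP q p)⁻¹ * (if q' ∈ N.inP p then N.wPQ p q' else 0)

/-- The constant in the term of the counter equation of `q` that comes from the place `p`. -/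
noncomputable def cost (N : FluidPetriNet P Q) (q : Q) (p : P) : ℝ :=
  N.routing q p * (N.wQP q p)⁻¹ * N.m p

lemma routing_mul_inv_nonneg (N : FluidPetriNet P Q) {q : Q} {p : P} (hp : p ∈ N.inQ q) :
    0 ≤ N.routing q p * (N.wQP q p)⁻¹ := by
  refine mul_nonneg ?_ (inv_nonneg.2 (N.wQP_pos q p hp).le)
  unfold routing
  split_ifs with h
  · exact N.prop_nonneg p h q hp
  · exact zero_le_one

lemma cost_nonneg (N : FluidPetriNet P Q) {q : Q} {p : P} (hp : p ∈ N.inQ q) :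
    0 ≤ N.cost q p :=
  mul_nonneg (N.routing_mul_inv_nonneg hp) (N.m_nonneg p)

lemma gain_nonneg (N : FluidPetriNet P Q) {q : Q} {p : P} (hp : p ∈ N.inQ q) (q' : Q) :
    0 ≤ N.gain q p q' := by
  refine mul_nonneg (N.routing_mul_inv_nonneg hp) ?_
  split_ifs with h
  · exact (N.wPQ_pos p q' h).le
  · exact le_rfl

lemma gain_eq_zero (N : FluidPetriNet P Q) {q : Q} {p : P} {q' : Q} (h : q' ∉ N.inP p) :
    N.gain q p q' = 0 := by
  simp [gain, h]

lemma sum_gain_mul (N : FluidPetriNet P Q) (q : Q) (p : P) (x : Q → ℝ) :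
    ∑ q', N.gain q p q' * x q' =
      N.routing q p * (N.wQP q p)⁻¹ * ∑ q' ∈ N.inP p, N.wPQ p q' * x q' := by
  classical
  simp only [gain, mul_assoc, ite_mul, zero_mul, ← Finset.mul_sum, Finset.sum_ite_mem,
    Finset.univ_inter]

lemma routing_mul_placeCounter (N : FluidPetriNet P Q) (q : Q) (p : P) (z : Q → ℝ → ℝ) (t : ℝ) :
    N.routing q p * (N.wQP q p)⁻¹ * N.placeCounter z p t =
      N.cost q p + ∑ q', N.gain q p q' * z q' t := by
  rw [sum_gain_mul N q p fun q' => z q' t, placeCounter, cost]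
  ring

lemma IsStoichiometricInvariant.sum_gain_mul {N : FluidPetriNet P Q} {e : Q → ℝ}
    (he : N.IsStoichiometricInvariant e) {q : Q} {p : P} (hp : p ∈ N.inQ q) :
    ∑ q', N.gain q p q' * e q' = e q := by
  rw [FluidPetriNet.sum_gain_mul, ← he q p hp]

/-- Comparing nonnegative combinations termwise only requires the comparison at the transitions
upstream of the place. -/
lemma sum_gain_mul_le (N : FluidPetriNet P Q) {q : Q} {p : P} (hp : p ∈ N.inQ q) {x y : Q → ℝ}
    (h : ∀ q' ∈ N.inP p, x q' ≤ y q') :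
    ∑ q', N.gain q p q' * x q' ≤ ∑ q', N.gain q p q' * y q' := by
  refine Finset.sum_le_sum fun q' _ => ?_
  by_cases hq' : q' ∈ N.inP p
  · exact mul_le_mul_of_nonneg_left (h q' hq') (N.gain_nonneg hp q')
  · simp [N.gain_eq_zero hq']

lemma eq_inf'_iff {ι : Type*} {s : Finset ι} (hs : s.Nonempty) (f : ι → ℝ) (a : ℝ) :
    a = s.inf' hs f ↔ (∀ i ∈ s, a ≤ f i) ∧ ∃ i ∈ s, a = f i := by
  constructor
  · rintro rfl
    exact ⟨fun i hi => Finset.inf'_le f hi, Finset.exists_mem_eq_inf' hs f⟩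
  · rintro ⟨h, i, hi, rfl⟩
    exact le_antisymm (Finset.le_inf' hs f h) (Finset.inf'_le f hi)

lemma satisfiesAt_iff (N : FluidPetriNet P Q) (z : Q → ℝ → ℝ) (t : ℝ) :
    N.SatisfiesAt z t ↔ ∀ q,
      (∀ p ∈ N.inQ q, z q t ≤ N.cost q p + ∑ q', N.gain q p q' * z q' (t - N.τ p)) ∧
      ∃ p ∈ N.inQ q, z q t = N.cost q p + ∑ q', N.gain q p q' * z q' (t - N.τ p) := by
  simp only [SatisfiesAt, eq_inf'_iff, routing_mul_placeCounter]

lemma τ_le_maxHolding (N : FluidPetriNet P Q) (p : P) : N.τ p ≤ N.maxHolding :=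
  le_ciSup (Set.finite_range N.τ).bddAbove p

lemma maxHolding_nonneg (N : FluidPetriNet P Q) : 0 ≤ N.maxHolding :=
  Real.iSup_nonneg N.τ_nonneg

/-! ### Potentials of non-Zeno nets -/

/-- A potential `K t + h q` on pairs (transition, time), which drops by at least `1` at each step
backwards through a place. -/
structure IsPotential (N : FluidPetriNet P Q) (K : ℝ) (h : Q → ℝ) : Prop where
  slope_nonneg : 0 ≤ K
  nonneg : ∀ q, 0 ≤ h q
  drop : ∀ q, ∀ p ∈ N.inQ q, ∀ q' ∈ N.inP p, h q' + 1 ≤ h q + K * N.τ p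

/-- In a non-Zeno net, the number of transitions from which `q` can be reached in zero time
increases strictly along the places with zero holding time. -/
lemma NonZeno.exists_isPotential {N : FluidPetriNet P Q} (hN : N.NonZeno) :
    ∃ K h, N.IsPotential K h := by
  classical
  let R : P ⊕ Q → P ⊕ Q → Prop := fun a b => N.Arc a b ∧ N.ZeroTime a ∧ N.ZeroTime b
  let S : Q → Finset Q := fun q => {q' | Relation.TransGen R (Sum.inr q') (Sum.inr q)}
  -- The slope `K` satisfies `K * τ p ≥ card Q + 1` whenever `τ p > 0`; places with `τ p = 0`
  -- contribute `0` to the sum.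
  refine ⟨∑ p, (Fintype.card Q + 1) / N.τ p, fun q => (S q).card, ?_, ?_, ?_⟩
  · exact Finset.sum_nonneg fun p _ => div_nonneg (by positivity) (N.τ_nonneg p)
  · intro q; positivity
  · intro q p hp q' hq'
    rcases (N.τ_nonneg p).eq_or_lt with h0 | hpos
    · have hstep : Relation.TransGen R (Sum.inr q') (Sum.inr q) :=
        .tail (.single ⟨.transitionToPlace q' p hq', trivial, h0.symm⟩)
          ⟨.placeToTransition p q hp, h0.symm, trivial⟩
      have hlt : S q' ⊂ S q := by
        refine Finset.ssubset_iff_of_subset ?_ |>.2 ⟨q', by simp [S, hstep], ?_⟩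
        · intro a ha
          simp only [S, Finset.mem_filter, Finset.mem_univ, true_and] at ha ⊢
          exact ha.trans hstep
        · simpa [S] using hN (Sum.inr q')
      rw [← h0, mul_zero, add_zero]
      exact_mod_cast Finset.card_lt_card hlt
    · have h1 : ((S q').card : ℝ) ≤ Fintype.card Q := by exact_mod_cast (S q').card_le_univ
      have h2 : (Fintype.card Q + 1 : ℝ) ≤ (∑ p, (Fintype.card Q + 1) / N.τ p) * N.τ p := by
        rw [← div_le_iff₀ hpos]
        exact Finset.single_le_sum (f := fun p => (Fintype.card Q + 1 : ℝ) / N.τ p)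
          (fun p _ => div_nonneg (by positivity) (N.τ_nonneg p)) (Finset.mem_univ p)
      have h3 : (0 : ℝ) ≤ (S q).card := by positivity
      linarith

/-- Induction backwards in time: a property of (transition, time) holds on `[-T, ∞)` if it holds
on `[-T, 0]` and propagates through the arguments of the counter equations. -/
lemma IsPotential.induction {N : FluidPetriNet P Q} {K : ℝ} {h : Q → ℝ} (hp : N.IsPotential K h)
    {motive : Q → ℝ → Prop} (init : ∀ q, ∀ t ∈ Set.Icc (-N.maxHolding) 0, motive q t)
    (step : ∀ q t, 0 < t → (∀ p ∈ N.inQ q, ∀ q' ∈ N.inP p, motive q' (t - N.τ p)) → motive q t)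
    (q : Q) (t : ℝ) (ht : -N.maxHolding ≤ t) : motive q t := by
  have key : ∀ n : ℕ, ∀ q t, -N.maxHolding ≤ t → K * (t + N.maxHolding) + h q < n →
      motive q t := by
    intro n
    induction n with
    | zero =>
      intro q t ht hlt
      have := mul_nonneg hp.slope_nonneg (show 0 ≤ t + N.maxHolding by linarith)
      have := hp.nonneg q
      norm_num at hlt
      linarith
    | succ n ih =>
      intro q t ht hlt
      rcases le_or_gt t 0 with h0 | h0
      · exact init q t ⟨ht, h0⟩
      · refine step q t h0 fun p hpq q' hq' => ih q' _ ?_ ?_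
        · linarith [N.τ_le_maxHolding p]
        · have := hp.drop q p hpq q' hq'
          push_cast at hlt
          linarith
  obtain ⟨n, hn⟩ := exists_nat_gt (K * (t + N.maxHolding) + h q)
  exact key n q t ht hn

/-! ### Comparison and existence of solutions -/

/-- The dynamics is monotone and commutes with the addition of multiples of a stoichiometric
invariant. -/
lemma NonZeno.le_add_of_initial {N : FluidPetriNet P Q} (hN : N.NonZeno) {e : Q → ℝ}
    (he : N.IsStoichiometricInvariant e) {z z' : Q → ℝ → ℝ}
    (hz : ∀ t, 0 < t → N.SatisfiesAt z t) (hz' : ∀ t, 0 < t → N.SatisfiesAt z' t) {C : ℝ}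
    (h0 : ∀ q, ∀ t ∈ Set.Icc (-N.maxHolding) 0, z q t ≤ z' q t + C * e q)
    (q : Q) (t : ℝ) (ht : -N.maxHolding ≤ t) : z q t ≤ z' q t + C * e q := by
  obtain ⟨K, h, hp⟩ := hN.exists_isPotential
  refine hp.induction (motive := fun q t => z q t ≤ z' q t + C * e q) h0 ?_ q t ht
  intro q t ht ih
  obtain ⟨p, hpq, hmin⟩ := ((N.satisfiesAt_iff z' t).1 (hz' t ht) q).2
  have hle := ((N.satisfiesAt_iff z t).1 (hz t ht) q).1 p hpq
  have hsum := N.sum_gain_mul_le hpq (ih p hpq)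
  have hadd : ∑ q', N.gain q p q' * (z' q' (t - N.τ p) + C * e q') =
      ∑ q', N.gain q p q' * z' q' (t - N.τ p) + C * e q := by
    rw [← he.sum_gain_mul hpq, Finset.mul_sum, ← Finset.sum_add_distrib]
    exact Finset.sum_congr rfl fun _ _ => by ring
  linarith

lemma NonZeno.abs_sub_le_of_initial {N : FluidPetriNet P Q} (hN : N.NonZeno) {e : Q → ℝ}
    (he : N.IsStoichiometricInvariant e) {z z' : Q → ℝ → ℝ}
    (hz : ∀ t, 0 < t → N.SatisfiesAt z t) (hz' : ∀ t, 0 < t → N.SatisfiesAt z' t) {C : ℝ}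
    (h0 : ∀ q, ∀ t ∈ Set.Icc (-N.maxHolding) 0, |z q t - z' q t| ≤ C * e q)
    (q : Q) (t : ℝ) (ht : -N.maxHolding ≤ t) : |z q t - z' q t| ≤ C * e q := by
  have h1 := hN.le_add_of_initial he hz hz' (C := C)
    (fun q t ht => by linarith [(abs_le.1 (h0 q t ht)).2]) q t ht
  have h2 := hN.le_add_of_initial he hz' hz (C := C)
    (fun q t ht => by linarith [(abs_le.1 (h0 q t ht)).1]) q t ht
  exact abs_le.2 ⟨by linarith, by linarith⟩

lemma NonZeno.eq_of_isSolution {N : FluidPetriNet P Q} (hN : N.NonZeno) {e : Q → ℝ}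
    (he : N.IsStoichiometricInvariant e) {φ z z' : Q → ℝ → ℝ} (hz : N.IsSolution φ z)
    (hz' : N.IsSolution φ z') (q : Q) (t : ℝ) (ht : -N.maxHolding ≤ t) : z q t = z' q t := by
  have := hN.abs_sub_le_of_initial he hz.2 hz'.2 (C := 0)
    (fun q t ht => by simp [hz.1 q t ht, hz'.1 q t ht]) q t ht
  rw [zero_mul] at this
  exact sub_eq_zero.1 (abs_nonpos_iff.1 this)

/-- The `n`-th iterate of the dynamics with initial condition `φ`. -/
noncomputable def iter (N : FluidPetriNet P Q) (φ : Q → ℝ → ℝ) : ℕ → Q → ℝ → ℝ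
  | 0 => φ
  | n + 1 => fun q t => if t ≤ 0 then φ q t else (N.inQ q).inf' (N.inQ_nonempty q) fun p =>
      N.cost q p + ∑ q', N.gain q p q' * iter N φ n q' (t - N.τ p)

lemma iter_of_nonpos (N : FluidPetriNet P Q) (φ : Q → ℝ → ℝ) (n : ℕ) (q : Q) {t : ℝ}
    (ht : t ≤ 0) : N.iter φ n q t = φ q t := by
  cases n with
  | zero => rfl
  | succ n => simp [iter, ht]

/-- At each transition and time, the iterates of the dynamics are eventually constant. -/
lemma NonZeno.exists_iter_eq {N : FluidPetriNet P Q} (hN : N.NonZeno) (φ : Q → ℝ → ℝ)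
    (q : Q) (t : ℝ) (ht : -N.maxHolding ≤ t) :
    ∃ a, ∀ᶠ n in atTop, N.iter φ n q t = a := by
  obtain ⟨K, h, hp⟩ := hN.exists_isPotential
  refine hp.induction (motive := fun q t => ∃ a, ∀ᶠ n in atTop, N.iter φ n q t = a) ?_ ?_ q t ht
  · exact fun q t ht => ⟨φ q t, .of_forall fun n => N.iter_of_nonpos φ n q ht.2⟩
  · intro q t ht ih
    choose! a ha using ih
    refine ⟨(N.inQ q).inf' (N.inQ_nonempty q) fun p => N.cost q p +
      ∑ q', N.gain q p q' * a p q', ?_⟩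
    have hall : ∀ᶠ n in atTop, ∀ p, p ∈ N.inQ q → ∀ q', q' ∈ N.inP p →
        N.iter φ n q' (t - N.τ p) = a p q' := by
      simp only [eventually_all]
      exact ha
    rw [← map_add_atTop_eq_nat 1, eventually_map]
    filter_upwards [hall] with n hn
    simp only [iter, not_le.2 ht, if_false]
    refine Finset.inf'_congr _ rfl fun p hpq => ?_
    congr 1
    refine Finset.sum_congr rfl fun q' _ => ?_
    by_cases hq' : q' ∈ N.inP p
    · rw [hn p hpq q' hq']
    · simp [N.gain_eq_zero hq']

lemma NonZeno.exists_isSolution {N : FluidPetriNet P Q} (hN : N.NonZeno) (φ : Q → ℝ → ℝ) :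
    ∃ z, N.IsSolution φ z := by
  choose! z hz using hN.exists_iter_eq φ
  have hz0 : ∀ q, ∀ t ∈ Set.Icc (-N.maxHolding) 0, z q t = φ q t := by
    intro q t ht
    obtain ⟨n, hn⟩ := (hz q t ht.1).exists
    rw [← hn, N.iter_of_nonpos φ n q ht.2]
  refine ⟨z, hz0, fun t ht q => ?_⟩
  have h1 : ∀ᶠ n in atTop, N.iter φ (n + 1) q t = z q t :=
    (tendsto_add_atTop_nat 1).eventually (hz q t (by linarith [N.maxHolding_nonneg]))
  have h2 : ∀ᶠ n in atTop, ∀ p, ∀ q', N.iter φ n q' (t - N.τ p) = z q' (t - N.τ p) := by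
    simp only [eventually_all]
    exact fun p q' => hz q' _ (by linarith [N.τ_le_maxHolding p])
  obtain ⟨n, hn1, hn2⟩ := (h1.and h2).exists
  rw [← hn1]
  simp only [iter, not_le.2 ht, if_false, hn2, routing_mul_placeCounter]

/-! ### The discounted equation -/

/-- The Bellman operator obtained by discounting the passage through `p` by `1 - lam * τ p`. -/
noncomputable def bellman (N : FluidPetriNet P Q) (lam : ℝ) (x : Q → ℝ) (q : Q) : ℝ :=
  (N.inQ q).inf' (N.inQ_nonempty q) fun p =>
    N.cost q p + (1 - lam * N.τ p) * ∑ q', N.gain q p q' * x q'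

lemma bellman_mono (N : FluidPetriNet P Q) {lam : ℝ} (hlam : ∀ p, lam * N.τ p ≤ 1) :
    Monotone (N.bellman lam) := by
  intro x y hxy q
  refine Finset.le_inf' _ _ fun p hp => (Finset.inf'_le _ hp).trans ?_
  have := mul_le_mul_of_nonneg_left (N.sum_gain_mul_le hp fun q' _ => hxy q')
    (sub_nonneg.2 (hlam p))
  linarith

lemma continuous_bellman (N : FluidPetriNet P Q) (lam : ℝ) : Continuous (N.bellman lam) := by
  refine continuous_pi fun q => ?_
  unfold bellman
  refine Continuous.finset_inf'_apply _ fun p _ => ?_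
  fun_prop

/-- The potential of a non-Zeno net provides a strict supersolution, of order `1 / lam`, of the
discounted equation. -/
lemma IsPotential.discounted_sum_le {N : FluidPetriNet P Q} {K : ℝ} {h : Q → ℝ}
    (hpot : N.IsPotential K h) {e : Q → ℝ} (he_pos : ∀ q, 0 < e q)
    (he : N.IsStoichiometricInvariant e) {lam : ℝ} (hlam0 : 0 < lam)
    {q : Q} {p : P} (hp : p ∈ N.inQ q) :
    (1 - lam * N.τ p) * ∑ q', N.gain q p q' * (e q' * (K / lam + h q')) ≤
      e q * (K / lam + h q) - e q := by
  -- Discounting the term `K / lam` yields `K / lam - K * τ p`, which offsets the increase of `h`.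
  have hsplit : ∑ q', N.gain q p q' * (e q' * (K / lam + h q')) =
      e q * (K / lam) + ∑ q', N.gain q p q' * (e q' * h q') := by
    rw [← he.sum_gain_mul hp, Finset.sum_mul, ← Finset.sum_add_distrib]
    exact Finset.sum_congr rfl fun _ _ => by ring
  have hle : ∑ q', N.gain q p q' * (e q' * h q') ≤ e q * (h q + K * N.τ p - 1) := by
    rw [← he.sum_gain_mul hp, Finset.sum_mul]
    simp only [mul_assoc]
    exact N.sum_gain_mul_le hp fun q' hq' => mul_le_mul_of_nonneg_left
      (by linarith [hpot.drop q p hp q' hq']) (he_pos q').le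
  have hnn : 0 ≤ ∑ q', N.gain q p q' * (e q' * h q') :=
    Finset.sum_nonneg fun q' _ =>
      mul_nonneg (N.gain_nonneg hp q') (mul_nonneg (he_pos q').le (hpot.nonneg q'))
  have hdisc : (1 - lam * N.τ p) * ∑ q', N.gain q p q' * (e q' * h q') ≤
      ∑ q', N.gain q p q' * (e q' * h q') :=
    mul_le_of_le_one_left hnn (by linarith [mul_nonneg hlam0.le (N.τ_nonneg p)])
  have hK : (1 - lam * N.τ p) * (e q * (K / lam)) = e q * (K / lam) - e q * (K * N.τ p) := by
    field_simp
  rw [hsplit, mul_add, hK]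
  linarith

lemma exists_cost_le (N : FluidPetriNet P Q) {e : Q → ℝ} (he_pos : ∀ q, 0 < e q) :
    ∃ c : ℝ, 0 ≤ c ∧ ∀ q, ∀ p ∈ N.inQ q, N.cost q p ≤ c * e q := by
  refine ⟨∑ x : Q × P, |N.cost x.1 x.2| / e x.1,
    Finset.sum_nonneg fun x _ => div_nonneg (abs_nonneg _) (he_pos _).le, fun q p hp => ?_⟩
  rw [← div_le_iff₀ (he_pos q)]
  refine (div_le_div_of_nonneg_right (le_abs_self _) (he_pos q).le).trans ?_
  exact Finset.single_le_sum (f := fun x : Q × P => |N.cost x.1 x.2| / e x.1)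
    (fun x _ => div_nonneg (abs_nonneg _) (he_pos _).le) (Finset.mem_univ (q, p))

/-- The iterates of a monotone continuous map of `ℝ^ι` that start below their image and stay
below a bound increase to a fixed point. -/
lemma exists_fixedPoint_of_monotone {ι : Type*} {T : (ι → ℝ) → ι → ℝ} (hmono : Monotone T)
    (hcont : Continuous T) {a w : ι → ℝ} (haw : a ≤ w) (ha : a ≤ T a) (hw : T w ≤ w) :
    ∃ v, T v = v ∧ a ≤ v ∧ v ≤ w := by
  have hm : Monotone fun n => T^[n] a := hmono.monotone_iterate_of_le_map ha
  have hb : ∀ n, T^[n] a ≤ w := by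
    intro n
    induction n with
    | zero => exact haw
    | succ n ih =>
      rw [Function.iterate_succ_apply']
      exact (hmono ih).trans hw
  have hlim : Tendsto (fun n => T^[n] a) atTop (nhds fun q => ⨆ n, T^[n] a q) :=
    tendsto_pi_nhds.2 fun q => tendsto_atTop_ciSup (fun i j hij => hm hij q)
      ⟨w q, by rintro _ ⟨n, rfl⟩; exact hb n q⟩
  exact ⟨_, isFixedPt_of_tendsto_iterate hlim hcont.continuousAt, hm.ge_of_tendsto hlim 0,
    le_of_tendsto' hlim hb⟩

/-- The discounted equation has a nonnegative solution, which is `O(1 / lam)`. -/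
lemma NonZeno.exists_bellman_eq {N : FluidPetriNet P Q} (hN : N.NonZeno) {e : Q → ℝ}
    (he_pos : ∀ q, 0 < e q) (he : N.IsStoichiometricInvariant e) :
    ∃ K : ℝ, ∃ h : Q → ℝ, ∀ lam, 0 < lam → (∀ p, lam * N.τ p ≤ 1) →
      ∃ v, N.bellman lam v = v ∧ ∀ q, 0 ≤ v q ∧ v q ≤ e q * (K / lam + h q) := by
  obtain ⟨K, h, hpot⟩ := hN.exists_isPotential
  obtain ⟨c, hc, hcost⟩ := N.exists_cost_le he_pos
  refine ⟨c * K, fun q => c * h q, fun lam hlam0 hlam => ?_⟩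
  have hw0 : ∀ q, 0 ≤ e q * (c * K / lam + c * h q) := fun q =>
    mul_nonneg (he_pos q).le (add_nonneg (div_nonneg (mul_nonneg hc hpot.slope_nonneg) hlam0.le)
      (mul_nonneg hc (hpot.nonneg q)))
  have hsub : 0 ≤ N.bellman lam 0 := fun q => Finset.le_inf' _ _ fun p hp => by
    simpa using N.cost_nonneg hp
  have hsuper : N.bellman lam (fun q => e q * (c * K / lam + c * h q)) ≤
      fun q => e q * (c * K / lam + c * h q) := by
    intro q
    obtain ⟨p, hp⟩ := N.inQ_nonempty q
    refine (Finset.inf'_le _ hp).trans ?_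
    have h1 := mul_le_mul_of_nonneg_left (hpot.discounted_sum_le he_pos he hlam0 hp) hc
    have h2 : ∑ q', N.gain q p q' * (e q' * (c * K / lam + c * h q')) =
        c * ∑ q', N.gain q p q' * (e q' * (K / lam + h q')) := by
      rw [Finset.mul_sum]
      exact Finset.sum_congr rfl fun _ _ => by ring
    have h3 := hcost q p hp
    have h4 : e q * (c * K / lam + c * h q) = c * (e q * (K / lam + h q)) := by ring
    rw [h2]
    refine le_of_le_of_eq ?_ h4.symm
    linarith
  obtain ⟨v, hv, h0, hw⟩ := exists_fixedPoint_of_monotone (N.bellman_mono hlam)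
    (N.continuous_bellman lam) hw0 hsub hsuper
  exact ⟨v, hv, fun q => ⟨h0 q, hw q⟩⟩

open Polynomial in
open Classical in
/-- The matrix of the discounted linear system under the policy `σ`, which selects one upstream
place for each transition. The indeterminate stands for the discount rate. -/
noncomputable def policyMatrix (N : FluidPetriNet P Q) (σ : Q → P) : Matrix Q Q ℝ[X] :=
  Matrix.of fun q q' => (if q = q' then 1 else 0) -
    (1 - X * C (N.τ (σ q))) * C (N.gain q (σ q) q')

open Classical in
lemma map_eval_policyMatrix (N : FluidPetriNet P Q) (σ : Q → P) (lam : ℝ) :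
    (N.policyMatrix σ).map (Polynomial.eval lam) = Matrix.of fun q q' =>
      (if q = q' then 1 else 0) - (1 - lam * N.τ (σ q)) * N.gain q (σ q) q' := by
  ext q q'
  simp only [policyMatrix, Matrix.map_apply, Matrix.of_apply]
  split_ifs <;> simp [mul_comm lam]

open Classical in
/-- Rescaled by the strict supersolution, the policy matrix is strictly diagonally dominant. -/
lemma NonZeno.eval_det_policyMatrix_ne_zero {N : FluidPetriNet P Q} (hN : N.NonZeno) {e : Q → ℝ}
    (he_pos : ∀ q, 0 < e q) (he : N.IsStoichiometricInvariant e) {σ : Q → P}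
    (hσ : ∀ q, σ q ∈ N.inQ q) {lam : ℝ} (hlam0 : 0 < lam) (hlam : ∀ p, lam * N.τ p ≤ 1) :
    (N.policyMatrix σ).det.eval lam ≠ 0 := by
  obtain ⟨K, h, hpot⟩ := hN.exists_isPotential
  set w : Q → ℝ := fun q => e q * (K / lam + h q) with hw
  have hw0 : ∀ q, 0 ≤ w q := fun q => mul_nonneg (he_pos q).le
    (add_nonneg (div_nonneg hpot.slope_nonneg hlam0.le) (hpot.nonneg q))
  have hdet : (N.policyMatrix σ).det.eval lam =
      ((N.policyMatrix σ).map (Polynomial.eval lam)).det := by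
    rw [← Polynomial.coe_evalRingHom, RingHom.map_det]
    rfl
  rw [hdet, map_eval_policyMatrix]
  refine fun h0 => det_ne_zero_of_sum_row_lt_diag
    (A := (Matrix.of fun q q' => (if q = q' then (1 : ℝ) else 0) -
      (1 - lam * N.τ (σ q)) * N.gain q (σ q) q') * Matrix.diagonal w) (fun q => ?_) (by
        rw [Matrix.det_mul, h0, zero_mul])
  have hd := hpot.discounted_sum_le he_pos he hlam0 (hσ q)
  have hnn : ∀ q', 0 ≤ (1 - lam * N.τ (σ q)) * N.gain q (σ q) q' := fun q' =>
    mul_nonneg (sub_nonneg.2 (hlam _)) (N.gain_nonneg (hσ q) q')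
  simp only [Matrix.mul_diagonal, Matrix.of_apply, Real.norm_eq_abs, if_true]
  refine lt_of_lt_of_le ?_ (le_abs_self _)
  have hoff : ∀ q' ∈ Finset.univ.erase q, |((if q = q' then (1 : ℝ) else 0) -
      (1 - lam * N.τ (σ q)) * N.gain q (σ q) q') * w q'| =
      (1 - lam * N.τ (σ q)) * N.gain q (σ q) q' * w q' := by
    intro q' hq'
    rw [if_neg (Finset.ne_of_mem_erase hq').symm, zero_sub, neg_mul, abs_neg,
      abs_of_nonneg (mul_nonneg (hnn q') (hw0 q'))]
  rw [Finset.sum_congr rfl hoff]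
  simp only [mul_assoc]
  rw [sub_mul, one_mul, mul_assoc, ← Finset.mul_sum, lt_sub_iff_add_lt, add_comm, ← mul_add,
    Finset.add_sum_erase Finset.univ (fun q' => N.gain q (σ q) q' * w q') (Finset.mem_univ q)]
  exact hd.trans_lt (sub_lt_self _ (he_pos q))

open Classical in
/-- Cramer's rule for the discounted linear system under a policy. -/
lemma eval_det_policyMatrix_mul (N : FluidPetriNet P Q) {σ : Q → P} {lam : ℝ} {v : Q → ℝ}
    (hv : ∀ q, v q = N.cost q (σ q) +
      (1 - lam * N.τ (σ q)) * ∑ q', N.gain q (σ q) q' * v q') (q : Q) :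
    (N.policyMatrix σ).det.eval lam * v q =
      (((N.policyMatrix σ).adjugate.mulVec
        fun q => Polynomial.C (N.cost q (σ q))) q).eval lam := by
  set A := (N.policyMatrix σ).map (Polynomial.evalRingHom lam) with hA
  have hAv : A.mulVec v = fun q => N.cost q (σ q) := by
    rw [hA, Polynomial.coe_evalRingHom, map_eval_policyMatrix]
    ext q
    have h1 : ∀ q', ((if q = q' then (1 : ℝ) else 0) -
        (1 - lam * N.τ (σ q)) * N.gain q (σ q) q') * v q' = (if q = q' then v q' else 0) -
        (1 - lam * N.τ (σ q)) * (N.gain q (σ q) q' * v q') := by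
      intro q'
      split_ifs <;> ring
    simp only [Matrix.mulVec, dotProduct, Matrix.of_apply, h1, Finset.sum_sub_distrib,
      Finset.sum_ite_eq, Finset.mem_univ, if_true, ← Finset.mul_sum]
    linarith [hv q]
  have hadj : A.adjugate = (N.policyMatrix σ).adjugate.map (Polynomial.evalRingHom lam) :=
    (RingHom.map_adjugate _ _).symm
  have hdet : (N.policyMatrix σ).det.eval lam = A.det := by
    rw [← Polynomial.coe_evalRingHom, RingHom.map_det]
    rfl
  have h1 : A.adjugate.mulVec (A.mulVec v) = A.det • v := by
    rw [Matrix.mulVec_mulVec, Matrix.adjugate_mul, Matrix.smul_mulVec, Matrix.one_mulVec]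
  rw [hdet]
  have h2 := congrFun h1 q
  rw [hAv, hadj] at h2
  rw [Pi.smul_apply, smul_eq_mul] at h2
  rw [← h2]
  simp [Matrix.mulVec, dotProduct, Polynomial.eval_finsetSum]

/-! ### Laurent expansion of bounded order -/

open Polynomial Topology in
/-- A function that satisfies a linear equation with polynomial coefficients and stays bounded
near `0` has a first order expansion at `0`. -/
lemma exists_slope_of_bounded {l : Filter ℝ} [l.NeBot] (hl : l ≤ 𝓝[≠] 0) {g : ℝ → ℝ} {B : ℝ}
    (hB : ∀ᶠ x in l, |g x| ≤ B) {D : ℝ[X]} (hD : D.eval 0 ≠ 0) (k : ℕ) (M : ℝ[X])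
    (h : ∀ᶠ x in l, x ^ k * D.eval x * g x = M.eval x) :
    ∃ a b, Tendsto (fun x => (g x - a) / x) l (𝓝 b) := by
  have hl0 : Tendsto id l (𝓝 (0 : ℝ)) := hl.trans nhdsWithin_le_nhds
  have hpoly : ∀ R : ℝ[X], Tendsto (fun x => R.eval x) l (𝓝 (R.eval 0)) := fun R =>
    R.continuous.continuousAt.tendsto.comp hl0
  induction k generalizing M with
  | zero =>
    have hder : HasDerivAt (fun x => M.eval x / D.eval x) _ 0 :=
      (M.hasDerivAt 0).div (D.hasDerivAt 0) hD
    refine ⟨M.eval 0 / D.eval 0, _,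
      ((hasDerivAt_iff_tendsto_slope.1 hder).mono_left hl).congr' ?_⟩
    filter_upwards [h, (hpoly D).eventually_ne hD] with x hx hDx
    rw [slope_def_field, sub_zero]
    congr 2
    rw [div_eq_iff hDx, ← hx]
    ring
  | succ k ih =>
    -- The left-hand side tends to `0`, so that `M` is divisible by `X`
    have hM0 : M.eval 0 = 0 := by
      have h1 : Tendsto (fun x => x ^ (k + 1) * D.eval x) l (𝓝 0) := by
        simpa [eval_mul, eval_pow, eval_X] using (hl0.pow (k + 1)).mul (hpoly D)
      have h2 : Tendsto (fun x => x ^ (k + 1) * D.eval x * g x) l (𝓝 0) :=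
        h1.zero_mul_isBoundedUnder_le ⟨B, by simpa using hB⟩
      exact tendsto_nhds_unique (hpoly M) (h2.congr' h)
    obtain ⟨M', rfl⟩ : X ∣ M := by
      rw [X_dvd_iff, coeff_zero_eq_eval_zero, hM0]
    refine ih M' ?_
    filter_upwards [h, hl self_mem_nhdsWithin] with x hx hx0
    have hx0 : x ≠ 0 := hx0
    rw [eval_mul, eval_X] at hx
    refine mul_left_cancel₀ hx0 ?_
    rw [← hx]
    ring

open Polynomial Topology in
/-- A rational function that is `O(1 / x)` at `0` equals `a / x + b + o(1)`. -/
lemma exists_laurent_of_bounded {l : Filter ℝ} [l.NeBot] (hl : l ≤ 𝓝[≠] 0) {f : ℝ → ℝ} {B : ℝ}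
    (hB : ∀ᶠ x in l, |x * f x| ≤ B) {D M : ℝ[X]} (hD : D ≠ 0)
    (h : ∀ᶠ x in l, D.eval x * f x = M.eval x) :
    ∃ a b, Tendsto (fun x => f x - a / x) l (𝓝 b) := by
  obtain ⟨D', hD', hnd⟩ := exists_eq_pow_rootMultiplicity_mul_and_not_dvd D hD 0
  rw [C_0, sub_zero] at hD' hnd
  obtain ⟨a, b, hab⟩ := exists_slope_of_bounded hl hB (D := D')
    (by rwa [X_dvd_iff, coeff_zero_eq_eval_zero] at hnd) (rootMultiplicity 0 D) (X * M) (by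
      filter_upwards [h] with x hx
      rw [hD', eval_mul, eval_pow, eval_X] at hx
      rw [eval_mul, eval_X, ← hx]
      ring)
  refine ⟨a, b, hab.congr' ?_⟩
  filter_upwards [hl self_mem_nhdsWithin] with x hx
  have hx : x ≠ 0 := hx
  field_simp

open Topology in
/-- If `a / x + b + o(1)` is nonnegative near `0+`, then `(a, b)` is lexicographically
nonnegative. -/
lemma lex_nonneg_of_laurent {l : Filter ℝ} [l.NeBot] (hl : l ≤ 𝓝[>] 0) {f : ℝ → ℝ} {a b : ℝ}
    (hf : Tendsto (fun x => f x - a / x) l (𝓝 b)) (hnn : ∀ᶠ x in l, 0 ≤ f x) :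
    0 ≤ a ∧ (a = 0 → 0 ≤ b) := by
  have hl0 : Tendsto id l (𝓝 (0 : ℝ)) := hl.trans nhdsWithin_le_nhds
  have hpos : ∀ᶠ x in l, 0 < x := hl self_mem_nhdsWithin
  constructor
  · have h1 : Tendsto (fun x => x * (f x - a / x) + a) l (𝓝 (0 * b + a)) :=
      (hl0.mul hf).add_const a
    rw [zero_mul, zero_add] at h1
    refine ge_of_tendsto h1 ?_
    filter_upwards [hnn, hpos] with x hx hx0
    have : x * (f x - a / x) + a = x * f x := by field_simp; ring
    rw [this]
    positivity
  · rintro rfl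
    refine ge_of_tendsto hf ?_
    filter_upwards [hnn] with x hx
    simpa using hx

/-! ### Existence of an affine stationary regime -/

open Topology in
/-- Along discount rates tending to `0`, a solution of the discounted equation attained by a
fixed policy expands as `ρ / lam + u + o(1)` with `ρ` nonnegative. -/
lemma NonZeno.exists_discounted_expansion {N : FluidPetriNet P Q} (hN : N.NonZeno) {e : Q → ℝ}
    (he_pos : ∀ q, 0 < e q) (he : N.IsStoichiometricInvariant e) :
    ∃ (l : Filter ℝ) (v : ℝ → Q → ℝ) (σ : Q → P) (ρ u : Q → ℝ), l.NeBot ∧ l ≤ 𝓝[>] 0 ∧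
      (∀ q, σ q ∈ N.inQ q) ∧ (∀ q, 0 ≤ ρ q) ∧
      (∀ᶠ x in l, ∀ q, ∀ p ∈ N.inQ q,
        v x q ≤ N.cost q p + (1 - x * N.τ p) * ∑ q', N.gain q p q' * v x q') ∧
      (∀ᶠ x in l, ∀ q,
        v x q = N.cost q (σ q) + (1 - x * N.τ (σ q)) * ∑ q', N.gain q (σ q) q' * v x q') ∧
      ∀ q, Tendsto (fun x => v x q - ρ q / x) l (𝓝 (u q)) := by
  classical
  obtain ⟨K, h, hK⟩ := hN.exists_bellman_eq he_pos he
  have hsmall : ∀ᶠ x in 𝓝[>] (0 : ℝ), ∀ p, x * N.τ p ≤ 1 := by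
    refine eventually_all.2 fun p => nhdsWithin_le_nhds ?_
    have : Tendsto (fun x : ℝ => x * N.τ p) (𝓝 0) (𝓝 0) := by
      simpa using (continuous_id.mul continuous_const).tendsto (0 : ℝ) (f := fun x => x * N.τ p)
    exact this.eventually_le_const one_pos
  choose! v hv hbound using hK
  have hpol : ∀ x, 0 < x → (∀ p, x * N.τ p ≤ 1) → ∃ σ : Q → P, ∀ q, σ q ∈ N.inQ q ∧
      v x q = N.cost q (σ q) + (1 - x * N.τ (σ q)) * ∑ q', N.gain q (σ q) q' * v x q' := by
    intro x hx hx1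
    choose σ hσ using fun q => ((eq_inf'_iff _ _ _).1 (congrFun (hv x hx hx1) q).symm).2
    exact ⟨σ, hσ⟩
  -- A policy that is optimal for arbitrarily small discount rates
  obtain ⟨σ, hσ⟩ : ∃ σ : Q → P, ∃ᶠ x in 𝓝[>] (0 : ℝ), ∀ q, σ q ∈ N.inQ q ∧
      v x q = N.cost q (σ q) + (1 - x * N.τ (σ q)) * ∑ q', N.gain q (σ q) q' * v x q' := by
    by_contra hcon
    simp only [not_exists, not_frequently] at hcon
    obtain ⟨x, hx, hx0, hx1⟩ :=
      ((eventually_all.2 hcon).and (eventually_mem_nhdsWithin.and hsmall)).exists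
    obtain ⟨σ, hσ⟩ := hpol x hx0 hx1
    exact hx σ hσ
  set l := 𝓝[>] (0 : ℝ) ⊓ 𝓟 {x | ∀ q, σ q ∈ N.inQ q ∧
      v x q = N.cost q (σ q) + (1 - x * N.τ (σ q)) * ∑ q', N.gain q (σ q) q' * v x q'} with hl_def
  have hne : l.NeBot := frequently_mem_iff_neBot.1 hσ
  have hl : l ≤ 𝓝[>] 0 := inf_le_left
  have hl' : l ≤ 𝓝[≠] 0 := hl.trans (nhdsWithin_mono _ fun x (hx : 0 < x) => hx.ne')
  have hσl : ∀ᶠ x in l, ∀ q, σ q ∈ N.inQ q ∧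
      v x q = N.cost q (σ q) + (1 - x * N.τ (σ q)) * ∑ q', N.gain q (σ q) q' * v x q' :=
    mem_inf_of_right (mem_principal_self _)
  have hpos : ∀ᶠ x in l, 0 < x := hl self_mem_nhdsWithin
  have hsmall' := hl hsmall
  have hσQ : ∀ q, σ q ∈ N.inQ q := by
    obtain ⟨x, hx⟩ := hσl.exists
    exact fun q => (hx q).1
  have hD : (N.policyMatrix σ).det ≠ 0 := by
    obtain ⟨x, hx0, hx1⟩ := (hpos.and hsmall').exists
    intro h0
    refine hN.eval_det_policyMatrix_ne_zero he_pos he hσQ hx0 hx1 ?_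
    rw [h0, Polynomial.eval_zero]
  have hexp : ∀ q, ∃ a b, Tendsto (fun x => v x q - a / x) l (𝓝 b) := by
    intro q
    have hone : ∀ᶠ x in l, x ≤ 1 :=
      (hl.trans nhdsWithin_le_nhds) (eventually_le_nhds zero_lt_one)
    refine exists_laurent_of_bounded hl' (B := e q * (K + |h q|)) ?_ hD ?_
      (M := ((N.policyMatrix σ).adjugate.mulVec fun q => Polynomial.C (N.cost q (σ q))) q)
    · filter_upwards [hpos, hsmall', hone] with x hx0 hx1 hx
      obtain ⟨h1, h2⟩ := hbound x hx0 hx1 q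
      rw [abs_of_nonneg (mul_nonneg hx0.le h1)]
      refine (mul_le_mul_of_nonneg_left h2 hx0.le).trans ?_
      have : x * (e q * (K / x + h q)) = e q * (K + x * h q) := by field_simp
      rw [this]
      refine mul_le_mul_of_nonneg_left ?_ (he_pos q).le
      have h3 : x * h q ≤ x * |h q| := mul_le_mul_of_nonneg_left (le_abs_self _) hx0.le
      have h4 : x * |h q| ≤ |h q| := mul_le_of_le_one_left (abs_nonneg _) hx
      linarith
    · filter_upwards [hσl] with x hx
      exact N.eval_det_policyMatrix_mul (fun q => (hx q).2) q
  choose ρ u hρu using hexp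
  refine ⟨l, v, σ, ρ, u, hne, hl, hσQ, fun q => ?_, ?_, hσl.mono fun x hx q => (hx q).2, hρu⟩
  · refine (lex_nonneg_of_laurent hl (hρu q) ?_).1
    filter_upwards [hpos, hsmall'] with x hx0 hx1
    exact (hbound x hx0 hx1 q).1
  · filter_upwards [hpos, hsmall'] with x hx0 hx1 q p hp
    exact ((eq_inf'_iff _ _ _).1 (congrFun (hv x hx0 hx1) q).symm).1 p hp

/-- The slack of the term of `p` in the equation of `q` at an affine trajectory is affine in time,
with the two coefficients that appear in the expansion of the discounted slack. -/
lemma affine_slack (N : FluidPetriNet P Q) (ρ u : Q → ℝ) (q : Q) (p : P) (t s : ℝ) :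
    N.cost q p + ∑ q', N.gain q p q' * (ρ q' * (t - N.τ p) + (u q' + s * ρ q')) -
        (ρ q * t + (u q + s * ρ q)) =
      (∑ q', N.gain q p q' * ρ q' - ρ q) * (t + s) +
        (N.cost q p - N.τ p * ∑ q', N.gain q p q' * ρ q' + ∑ q', N.gain q p q' * u q' - u q) := by
  have : ∑ q', N.gain q p q' * (ρ q' * (t - N.τ p) + (u q' + s * ρ q')) =
      (t - N.τ p + s) * ∑ q', N.gain q p q' * ρ q' + ∑ q', N.gain q p q' * u q' := by
    rw [Finset.mul_sum, ← Finset.sum_add_distrib]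
    exact Finset.sum_congr rfl fun _ _ => by ring
  rw [this]
  ring

open Topology in
lemma tendsto_discounted_slack (N : FluidPetriNet P Q) {l : Filter ℝ} (hl : l ≤ 𝓝[>] 0)
    {v : ℝ → Q → ℝ} {ρ u : Q → ℝ} (hv : ∀ q, Tendsto (fun x => v x q - ρ q / x) l (𝓝 (u q)))
    (q : Q) (p : P) :
    Tendsto (fun x => (N.cost q p + (1 - x * N.τ p) * ∑ q', N.gain q p q' * v x q' - v x q) -
        (∑ q', N.gain q p q' * ρ q' - ρ q) / x) l
      (𝓝 (N.cost q p - N.τ p * ∑ q', N.gain q p q' * ρ q' +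
        ∑ q', N.gain q p q' * u q' - u q)) := by
  have hl0 : Tendsto id l (𝓝 (0 : ℝ)) := hl.trans nhdsWithin_le_nhds
  have hpos : ∀ᶠ x in l, 0 < x := hl self_mem_nhdsWithin
  have h1 : Tendsto (fun x => ∑ q', N.gain q p q' * (v x q' - ρ q' / x)) l
      (𝓝 (∑ q', N.gain q p q' * u q')) :=
    tendsto_finsetSum _ fun q' _ => (hv q').const_mul _
  have h2 : Tendsto (fun x : ℝ => 1 - x * N.τ p) l (𝓝 (1 - 0 * N.τ p)) :=
    (hl0.mul_const _).const_sub _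
  have h3 := (((h2.mul h1).const_add
    (N.cost q p - N.τ p * ∑ q', N.gain q p q' * ρ q')).sub (hv q))
  rw [zero_mul, sub_zero, one_mul] at h3
  refine h3.congr' ?_
  filter_upwards [hpos] with x hx
  have h4 : ∑ q', N.gain q p q' * (v x q' - ρ q' / x) =
      ∑ q', N.gain q p q' * v x q' - (∑ q', N.gain q p q' * ρ q') / x := by
    rw [Finset.sum_div, ← Finset.sum_sub_distrib]
    exact Finset.sum_congr rfl fun _ _ => by ring
  rw [h4]
  field_simp
  ring

theorem NonZeno.exists_isAffineStationaryRegime {N : FluidPetriNet P Q} (hN : N.NonZeno)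
    {e : Q → ℝ} (he_pos : ∀ q, 0 < e q) (he : N.IsStoichiometricInvariant e) :
    ∃ ρ u : Q → ℝ, N.IsAffineStationaryRegime ρ u := by
  obtain ⟨l, v, σ, ρ, u, hne, hl, hσ, hρ, hle, heq, hlim⟩ :=
    hN.exists_discounted_expansion he_pos he
  set a : Q → P → ℝ := fun q p => ∑ q', N.gain q p q' * ρ q' - ρ q with ha
  set b : Q → P → ℝ := fun q p => N.cost q p - N.τ p * ∑ q', N.gain q p q' * ρ q' +
    ∑ q', N.gain q p q' * u q' - u q with hb
  have hlex : ∀ q, ∀ p ∈ N.inQ q, 0 ≤ a q p ∧ (a q p = 0 → 0 ≤ b q p) := fun q p hp =>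
    lex_nonneg_of_laurent hl (N.tendsto_discounted_slack hl hlim q p)
      (hle.mono fun x hx => sub_nonneg.2 (hx q p hp))
  have hzero : ∀ q, a q (σ q) = 0 ∧ b q (σ q) = 0 := by
    intro q
    obtain ⟨h1, h2⟩ := hlex q (σ q) (hσ q)
    have hneg := (N.tendsto_discounted_slack hl hlim q (σ q)).neg
    obtain ⟨h3, h4⟩ := lex_nonneg_of_laurent hl (a := -a q (σ q)) (b := -b q (σ q))
      (f := fun x => -(N.cost q (σ q) +
        (1 - x * N.τ (σ q)) * ∑ q', N.gain q (σ q) q' * v x q' - v x q))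
      (hneg.congr fun x => by simp only [ha]; ring)
      (heq.mono fun x hx => by rw [← hx q, sub_self, neg_zero])
    have ha0 : a q (σ q) = 0 := le_antisymm (by linarith) h1
    exact ⟨ha0, le_antisymm (by linarith [h4 (by rw [ha0, neg_zero])]) (h2 ha0)⟩
  -- From some time `s` on, every slack is nonnegative
  obtain ⟨s, hs⟩ : ∃ s, ∀ t, s ≤ t → ∀ q, ∀ p, p ∈ N.inQ q → 0 ≤ a q p * t + b q p := by
    refine eventually_atTop.1 ?_
    simp only [eventually_all]
    intro q p hp
    obtain ⟨h1, h2⟩ := hlex q p hp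
    rcases h1.eq_or_lt with h0 | h0
    · exact .of_forall fun t => by rw [← h0, zero_mul, zero_add]; exact h2 h0.symm
    · exact (tendsto_atTop_add_const_right _ _
        (tendsto_id.const_mul_atTop h0)).eventually_ge_atTop 0
  refine ⟨ρ, fun q => u q + s * ρ q, hρ, fun t ht => (N.satisfiesAt_iff _ t).2 fun q => ?_⟩
  refine ⟨fun p hp => ?_, σ q, hσ q, ?_⟩
  · rw [← sub_nonneg, N.affine_slack]
    exact hs (t + s) (by linarith) q p hp
  · refine (sub_eq_zero.1 ?_).symm
    rw [N.affine_slack]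
    change a q (σ q) * (t + s) + b q (σ q) = 0
    rw [(hzero q).1, (hzero q).2, zero_mul, zero_add]

/-- All solutions with bounded initial conditions stay at bounded distance from an affine
stationary regime. -/
lemma NonZeno.isBigO_sub_of_isSolution {N : FluidPetriNet P Q} (hN : N.NonZeno) {e : Q → ℝ}
    (he_pos : ∀ q, 0 < e q) (he : N.IsStoichiometricInvariant e) {ρ u : Q → ℝ}
    (hρ : N.IsAffineStationaryRegime ρ u) {φ z : Q → ℝ → ℝ} (hφ : N.BoundedInitial φ)
    (hz : N.IsSolution φ z) (q : Q) :
    (fun t => z q t - ρ q * t) =O[atTop] (fun _ => (1 : ℝ)) := by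
  obtain ⟨B, hB⟩ := hφ
  set D : Q → ℝ := fun q => |B| + (ρ q * N.maxHolding + |u q|) with hD
  have hD0 : ∀ q, 0 ≤ D q := fun q =>
    add_nonneg (abs_nonneg _)
      (add_nonneg (mul_nonneg (hρ.1 q) N.maxHolding_nonneg) (abs_nonneg _))
  have hbound := hN.abs_sub_le_of_initial he hz.2 (fun t ht => hρ.2 t ht.le)
    (C := ∑ q, D q / e q) (by
      intro q t ht
      have h1 : |z q t - (ρ q * t + u q)| ≤ D q := by
        rw [hz.1 q t ht]
        have h2 : |ρ q * t| ≤ ρ q * N.maxHolding := by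
          rw [abs_mul, abs_of_nonneg (hρ.1 q)]
          exact mul_le_mul_of_nonneg_left
            (abs_le.2 ⟨ht.1, ht.2.trans N.maxHolding_nonneg⟩) (hρ.1 q)
        exact (abs_sub _ _).trans (add_le_add ((hB q t ht).trans (le_abs_self B))
          ((abs_add_le _ _).trans (add_le_add h2 le_rfl)))
      refine h1.trans ?_
      rw [← div_le_iff₀ (he_pos q)]
      exact Finset.single_le_sum (f := fun q => D q / e q)
        (fun q _ => div_nonneg (hD0 q) (he_pos q).le) (Finset.mem_univ q)) q
  refine IsBigO.of_bound ((∑ q, D q / e q) * e q + |u q|) ?_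
  filter_upwards [eventually_ge_atTop 0] with t ht
  have h1 := hbound t (by linarith [N.maxHolding_nonneg])
  rw [norm_one, mul_one, Real.norm_eq_abs]
  have h2 : z q t - ρ q * t = (z q t - (ρ q * t + u q)) + u q := by ring
  rw [h2]
  exact (abs_add_le _ _).trans (add_le_add h1 le_rfl)

end FluidPetriNet

theorem mainTheorem1 {P Q : Type*} [Fintype P] [Fintype Q] [DecidableEq P]
    (N : FluidPetriNet P Q) (hN : N.NonZeno)
    (e : Q → ℝ) (he_pos : ∀ q, 0 < e q) (he : N.IsStoichiometricInvariant e) :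
    (∃ ρ u : Q → ℝ, N.IsAffineStationaryRegime ρ u ∧
      ∀ z : Q → ℝ → ℝ, N.IsSolution (fun q t => ρ q * t + u q) z →
        ∀ q, ∀ t, 0 ≤ t → z q t = ρ q * t + u q) ∧
    (∀ ρ u : Q → ℝ, N.IsAffineStationaryRegime ρ u →
      ∀ φ : Q → ℝ → ℝ, N.BoundedInitial φ →
        (∃ z : Q → ℝ → ℝ, N.IsSolution φ z) ∧
        (∀ z z' : Q → ℝ → ℝ, N.IsSolution φ z → N.IsSolution φ z' →
          ∀ q, ∀ t, -N.maxHolding ≤ t → z q t = z' q t) ∧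
        ∀ z : Q → ℝ → ℝ, N.IsSolution φ z →
          ∀ q, (fun t => z q t - ρ q * t) =O[atTop] (fun _ => (1 : ℝ))) := by
  obtain ⟨ρ, u, hρ⟩ := hN.exists_isAffineStationaryRegime he_pos he
  refine ⟨⟨ρ, u, hρ, fun z hz q t ht => ?_⟩, fun ρ u hρ φ hφ => ⟨hN.exists_isSolution φ,
    fun z z' hz hz' => hN.eq_of_isSolution he hz hz',
    fun z hz => hN.isBigO_sub_of_isSolution he_pos he hρ hφ hz⟩⟩
  exact hN.eq_of_isSolution he hz (z' := fun q t => ρ q * t + u q)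
    ⟨fun _ _ _ => rfl, fun t ht => hρ.2 t ht.le⟩ q t (by linarith [N.maxHolding_nonneg])
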